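/- **Corollary (Verification–simulation gap).** *Protocol.* Let $\mathsf{CSS}(C_X,C_Z)$ be given by binary linear codes $C_X,C_Z\le\mathbb F_2^n$ with $C_Z^\perp\subseteq C_X$, $k_x=\dim C_X$, $k_z=\dim C_Z$, $k=k_x+k_z-n$. Let $V\in GL(n,\mathbb F_2)$ be the linear map of a CNOT network encoding it: $V$ maps $|{+^k}\rangle|{+^{n-k_x}}\rangle|0^{n-k_z}\rangle$ to $|\overline{+}\rangle=|C_Z\rangle$ and $|0^k\rangle|{+^{n-k_x}}\rangle|0^{n-k_z}\rangle$ to $|\overline 0\rangle=|C_X^\perp\rangle$, where $|C\rangle=|C|^{-1/2}\sum_{w\in C}|w\rangle$. Let $U(\theta)=(e^{i\theta Z})^{\otimes n}$. *Simulating the protocol* means sampling the $X$-basis outcome $x\in\{0,1\}^n$ of $U(\theta)|\overline{+}\rangle$. The *syndrome* of $x$ is $s=(V^{T}x)_{[k+1,\,k+n-k_x]}$. *Verifying the syndrome distribution* means sampling $s$ after the logical register has been set to $|0^k\rangle$, i.e. the syndrome of the $X$-basis outcome of $U(\theta)|\overline{0}\rangle$. *Time.* The time for sampling a distribution on bit strings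 to accuracy $\delta$ is the least number of elementary steps (fair coin tosses and binary Boolean gates) of a classical randomized straight-line program whose output is within total variation distance $\delta$ of it. Fix accuracies $\delta(n)>0$; sampling tasks for $n$-qubit states are to accuracy $\delta(n)$. The verification-simulation gap of an instance is the ratio of its simulation time and its verification time. *Statement.* Let $c>0$, $0<\alpha<1$ and $|\theta|\le\arcsin\!\big(\tfrac{\alpha}{2e(4e+2)}\big)$. Let $\mathcal S$ be a class of pairs consisting of a state $e^{i\theta\sum_{i=1}^n Z_{V(i)}}|{+^a}\rangle|0^b\rangle$ and a Pauli basis; here $a+b=n$, the $a$ qubits in $|+\rangle$ may be in any positions, $V(i)$ is the $i$-th row of $V\in\mathbb F_2^{n\times n}$ and $Z_v=\prod_j Z_j^{v_j}$. Suppose that the time for sampling the outcome in the Pauli basis is $\Theta(2^{ca})$ on $\mathcal S$ as $a\to\infty$. Consider a family of codes $\mathsf{CSS}(C_X,C_Z)$ with encoders $V$ and $n\to\infty$, such that $C_X$ corrects $t\ge\alpha n$ errors and such that $\mathcal S$ contains the states $e^{i\theta\sum_i Z_{V(i)}}|{+^k}\rangle|{+^{n-k_x}}\rangle|0^{n-k_z}\rangle$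 and $e^{i\theta\sum_i Z_{V(i)}}|0^k\rangle|{+^{n-k_x}}\rangle|0^{n-k_z}\rangle$ with the $X$ basis. Then, along the family: 1. simulating the protocol takes time $\Theta(2^{c(k+n-k_x)})$; 2. verifying the syndrome distribution takes time $\Theta(2^{c(n-k_x)})$; 3. the verification-simulation gap is $\Theta(2^{ck})$; 4. the total variation distance $\nu$ between the syndrome distributions of $U(\theta)|\overline{+}\rangle$ and $U(\theta)|\overline{0}\rangle$ is negligible in $n$ (that is, $n^p\nu\to0$ for every $p$), and the ideal syndrome distribution, that of $U(\theta)|\overline{+}\rangle$, can be sampled to accuracy $\delta(n)+\nu$ in time $O(2^{c(n-k_x)})$. -/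

import Mathlib

open Filter Topology Asymptotics

noncomputable section

/-! ### Classical sampling with a step count -/

/-- One elementary step: toss a fair coin, or apply an arbitrary binary Boolean gate to the bits
computed in steps number `i` and `j`. The resulting bit is appended to the memory. -/
inductive SamplerStep where
  | coin : SamplerStep
  | gate (f : ZMod 2 → ZMod 2 → ZMod 2) (i j : ℕ) : SamplerStep

/-- Distribution of the final memory when the steps are executed in order from memory `w`.
A memory cell that was never written reads as `0`. -/
def runSteps : List SamplerStep → List (ZMod 2) → PMF (List (ZMod 2))
  | [], w => PMF.pure w
  | SamplerStep.coin :: p, w =>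
      (PMF.uniformOfFintype (ZMod 2)).bind fun r => runSteps p (w ++ [r])
  | SamplerStep.gate f i j :: p, w => runSteps p (w ++ [f (w.getD i 0) (w.getD j 0)])

/-- A classical randomized sampler of bit strings indexed by `κ`: a list of elementary steps and,
for every output bit, the memory cell from which it is read. -/
structure Sampler (κ : Type*) where
  steps : List SamplerStep
  out : κ → ℕ

/-- The running time of a sampler: its number of elementary steps. -/
def Sampler.time {κ : Type*} (A : Sampler κ) : ℕ := A.steps.length

/-- The output distribution of a sampler. -/
def Sampler.dist {κ : Type*} (A : Sampler κ) : PMF (κ → ZMod 2) :=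
  (runSteps A.steps []).map fun w j => w.getD (A.out j) 0

/-- Total variation distance of two distributions on a finite set, given by their weights. -/
def tvDist {X : Type*} [Fintype X] (P Q : X → ℝ) : ℝ := (1 / 2) * ∑ x, |P x - Q x|

/-- The time it takes to sample classically from `D` up to total variation distance `δ`: the least
number of elementary steps of a randomized sampler. (For `δ > 0` and a probability
distribution `D` such samplers exist.) -/
def samplingTime {κ : Type*} [Fintype κ] [DecidableEq κ] (δ : ℝ) (D : (κ → ZMod 2) → ℝ) : ℕ :=
  sInf {T | ∃ A : Sampler κ, A.time = T ∧ tvDist (fun x => (A.dist x).toReal) D ≤ δ}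

/-! ### Qubits -/

/-- Amplitudes of an `n`-qubit state in the computational basis. -/
abbrev QState (n : ℕ) := (Fin n → ZMod 2) → ℂ

/-- Operators on `n` qubits, as matrices in the computational basis. -/
abbrev QOp (n : ℕ) := Matrix (Fin n → ZMod 2) (Fin n → ZMod 2) ℂ

/-- The tensor product of single-qubit operators. -/
def tensorOp {n : ℕ} (A : Fin n → Matrix (ZMod 2) (ZMod 2) ℂ) : QOp n :=
  Matrix.of fun x y => ∏ i, A i (x i) (y i)

/-- The Pauli matrix `Z`. -/
def pauliZ : Matrix (ZMod 2) (ZMod 2) ℂ := Matrix.diagonal fun b => if b = 0 then 1 else -1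

/-- `Z_v = ∏ i, Z_i ^ (v i)`. -/
def pauliZString {n : ℕ} (v : Fin n → ZMod 2) : QOp n := tensorOp fun i => pauliZ ^ (v i).val

/-- The coherent error `U(θ) = (e^{iθZ})^{⊗n}`. -/
def coherentError (n : ℕ) (θ : ℝ) : QOp n :=
  tensorOp fun _ => NormedSpace.exp ((Complex.I * (θ : ℂ)) • pauliZ)

/-- `e^{iθ ∑ i, Z_{V(i)}}`, where `V(i)` is the `i`-th row of `V`. -/
def zRotation {n : ℕ} (θ : ℝ) (V : Matrix (Fin n) (Fin n) (ZMod 2)) : QOp n :=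
  NormedSpace.exp ((Complex.I * (θ : ℂ)) • ∑ i, pauliZString (V i))

/-- The product state with `|+⟩` on the qubits in `S` and `|0⟩` on all others. -/
def plusZeroState {n : ℕ} (S : Finset (Fin n)) : QState n := fun w =>
  ∏ i, if i ∈ S then (1 / (Real.sqrt 2 : ℂ)) else if w i = 0 then 1 else 0

open scoped Classical in
/-- The subspace state `|C⟩ = |C|^{-1/2} ∑_{w ∈ C} |w⟩`. -/
def subspaceState {n : ℕ} (C : Submodule (ZMod 2) (Fin n → ZMod 2)) : QState n := fun w =>
  if w ∈ C then 1 / (Real.sqrt (Nat.card C) : ℂ) else 0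

/-- The three single-qubit Pauli bases. -/
inductive PauliAxis where
  | X : PauliAxis
  | Y : PauliAxis
  | Z : PauliAxis

/-- The matrix whose row `b` is the bra of the eigenvector of the given Pauli operator with
eigenvalue `(-1)^b`. For `X` this is the Hadamard matrix. -/
def PauliAxis.bra : PauliAxis → Matrix (ZMod 2) (ZMod 2) ℂ
  | X => Matrix.of fun b w => (1 / (Real.sqrt 2 : ℂ)) * (if b = 1 ∧ w = 1 then -1 else 1)
  | Y => Matrix.of fun b w => (1 / (Real.sqrt 2 : ℂ)) *
      (if w = 0 then 1 else if b = 0 then -Complex.I else Complex.I)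
  | Z => 1

/-- Outcome distribution when qubit `i` of `ψ` is measured in the Pauli basis `B i`. -/
def pauliMeasure {n : ℕ} (B : Fin n → PauliAxis) (ψ : QState n) : (Fin n → ZMod 2) → ℝ := fun x =>
  ‖(tensorOp fun i => (B i).bra).mulVec ψ x‖ ^ 2

/-! ### States of the form `e^{iθ ∑ Z_{V(i)}} |+^a⟩|0^b⟩` with a Pauli measurement -/

/-- A choice of `V`, of the qubits that start in `|+⟩` (all others start in `|0⟩`) and of a Pauli
basis to measure in. -/
structure RotatedInstance where
  n : ℕ
  V : Matrix (Fin n) (Fin n) (ZMod 2)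
  plus : Finset (Fin n)
  basis : Fin n → PauliAxis

/-- The number `a` of qubits that start in `|+⟩`. -/
def RotatedInstance.a (S : RotatedInstance) : ℕ := S.plus.card

/-- The output distribution of `e^{iθ ∑ Z_{V(i)}} |+^a⟩|0^b⟩` in the chosen Pauli basis. -/
def RotatedInstance.dist (θ : ℝ) (S : RotatedInstance) : (Fin S.n → ZMod 2) → ℝ :=
  pauliMeasure S.basis ((zRotation θ S.V).mulVec (plusZeroState S.plus))

/-! ### CSS codes and the protocol -/

/-- The dual code `C^⊥`. -/
def dualCode {n : ℕ} (C : Submodule (ZMod 2) (Fin n → ZMod 2)) :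
    Submodule (ZMod 2) (Fin n → ZMod 2) where
  carrier := {x | ∀ y ∈ C, x ⬝ᵥ y = 0}
  zero_mem' := fun y _ => by simp
  add_mem' := fun {x x'} hx hx' y hy => by simp [add_dotProduct, hx y hy, hx' y hy]
  smul_mem' := fun r x hx y hy => by simp [smul_dotProduct, hx y hy]

/-- `C` corrects `t` errors: distinct errors of weight at most `t` have distinct syndromes. -/
def CorrectsErrors {n : ℕ} (C : Submodule (ZMod 2) (Fin n → ZMod 2)) (t : ℕ) : Prop :=
  ∀ e e' : Fin n → ZMod 2, hammingNorm e ≤ t → hammingNorm e' ≤ t → e - e' ∈ C → e = e'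

/-- A code `CSS(C_X, C_Z)` on `n` qubits, `C_Z^⊥ ⊆ C_X`. -/
structure CSSCode where
  n : ℕ
  CX : Submodule (ZMod 2) (Fin n → ZMod 2)
  CZ : Submodule (ZMod 2) (Fin n → ZMod 2)
  dual_le : dualCode CZ ≤ CX

namespace CSSCode

def kx (Q : CSSCode) : ℕ := Module.finrank (ZMod 2) Q.CX

def kz (Q : CSSCode) : ℕ := Module.finrank (ZMod 2) Q.CZ

/-- The number of logical qubits; `n ≤ k_x + k_z` because `C_Z^⊥ ⊆ C_X`. -/
def k (Q : CSSCode) : ℕ := Q.kx + Q.kz - Q.n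

/-- In unencoded form, qubits `1, …, k` are logical qubits, the next `n - k_x` qubits carry the
`X`-syndrome and the last `n - k_z` qubits are in `|0⟩`. This is the syndrome register. -/
def syndromeRegister (Q : CSSCode) : Finset (Fin Q.n) :=
  Finset.univ.filter fun j => Q.k ≤ j.val ∧ j.val < Q.k + (Q.n - Q.kx)

/-- The logical and the syndrome register together. -/
def plusRegister (Q : CSSCode) : Finset (Fin Q.n) :=
  Finset.univ.filter fun j => j.val < Q.k + (Q.n - Q.kx)

/-- `V ∈ GL(n, 𝔽₂)` is the linear map `|w⟩ ↦ |V w⟩` of a CNOT network that encodes the code: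
it takes `|+^k⟩|+^{n-k_x}⟩|0^{n-k_z}⟩` to `|C_Z⟩` and `|0^k⟩|+^{n-k_x}⟩|0^{n-k_z}⟩` to `|C_X^⊥⟩`. -/
def IsEncoder (Q : CSSCode) (V : Matrix (Fin Q.n) (Fin Q.n) (ZMod 2)) : Prop :=
  IsUnit V ∧
  Submodule.span (ZMod 2) ((fun j i => V i j) '' (Q.plusRegister : Set (Fin Q.n))) = Q.CZ ∧
  Submodule.span (ZMod 2) ((fun j i => V i j) '' (Q.syndromeRegister : Set (Fin Q.n)))
    = dualCode Q.CX

/-- The code state with all logical qubits in `|+⟩`, which is `|C_Z⟩`. -/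
def logicalPlus (Q : CSSCode) : QState Q.n := subspaceState Q.CZ

/-- The code state with all logical qubits in `|0⟩`, which is `|C_X^⊥⟩`. -/
def logicalZero (Q : CSSCode) : QState Q.n := subspaceState (dualCode Q.CX)

/-- Distribution of the `X`-basis outcome `x` after the coherent error on the code state `ψ`. -/
def outcomeDist (Q : CSSCode) (θ : ℝ) (ψ : QState Q.n) : (Fin Q.n → ZMod 2) → ℝ :=
  pauliMeasure (fun _ => PauliAxis.X) ((coherentError Q.n θ).mulVec ψ)

/-- Distribution of the syndrome of the outcome `x`: the syndrome register of `y = T x`, where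
`T = Vᵀ` is the unencoding map of `X`-basis outcomes. -/
def syndromeDist (Q : CSSCode) (V : Matrix (Fin Q.n) (Fin Q.n) (ZMod 2)) (θ : ℝ)
    (ψ : QState Q.n) : (Q.syndromeRegister → ZMod 2) → ℝ := fun s =>
  ∑ x : Fin Q.n → ZMod 2,
    if (fun j : Q.syndromeRegister => V.transpose.mulVec x j) = s then Q.outcomeDist θ ψ x else 0

/-- Time to simulate the protocol: to sample the outcomes of the ideal experiment. -/
def simulationTime (Q : CSSCode) (θ δ : ℝ) : ℕ :=
  samplingTime δ (Q.outcomeDist θ Q.logicalPlus)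

/-- Time to verify the syndrome distribution: to simulate it with the logical register of the
code state set to `|0^k⟩`. -/
def verificationTime (Q : CSSCode) (V : Matrix (Fin Q.n) (Fin Q.n) (ZMod 2)) (θ δ : ℝ) : ℕ :=
  samplingTime δ (Q.syndromeDist V θ Q.logicalZero)

/-- `e^{iθ ∑ Z_{V(i)}} |+^k⟩|+^{n-k_x}⟩|0^{n-k_z}⟩`, measured in the `X` basis. -/
def fullInstance (Q : CSSCode) (V : Matrix (Fin Q.n) (Fin Q.n) (ZMod 2)) : RotatedInstance :=
  ⟨Q.n, V, Q.plusRegister, fun _ => PauliAxis.X⟩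

/-- `e^{iθ ∑ Z_{V(i)}} |0^k⟩|+^{n-k_x}⟩|0^{n-k_z}⟩`, measured in the `X` basis. -/
def zeroInstance (Q : CSSCode) (V : Matrix (Fin Q.n) (Fin Q.n) (ZMod 2)) : RotatedInstance :=
  ⟨Q.n, V, Q.syndromeRegister, fun _ => PauliAxis.X⟩

end CSSCode

end

/-!
The encoding network maps computational basis states to computational basis states, so it carries
the coherent error `U(θ)` on a code state to the diagonal rotation `e^{iθ ∑ Z_{V(i)}}` of a product
state, and it acts on `X`-basis outcomes as the linear map `Vᵀ` (`outcomeDist_subspaceState`).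
Hence sampling the protocol and sampling the rotated product state differ by a linear map over
`𝔽₂`, that is by at most `n (n + 1)` gates. In the state with `|+⟩` exactly on the syndrome
register, all outcome bits outside that register are fair coins, independent of the syndrome
(`rotatedInstance_dist_eq_coinFill`), so sampling the syndrome and sampling the whole outcome
differ by at most `n` steps. These overheads do not matter: all errors supported on a fixed set of
`m ≤ t` qubits have distinct syndromes, so `n - k_x ≥ α n` (`CSSCode.le_card_syndromeRegister`),
and the costs `2^{c a}` of the class are exponential in `n`.

For the distance of the two syndrome distributions, expand `U(θ) = ∑ₑ a(e) Z^e`. The probability of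
a syndrome is a sum, over classes of errors that act alike on the given state, of the squared total
amplitude of the class (`syndromeDist_subspaceState`); the classes are coarser for `|0⟩` than for
`|+⟩`. Without errors of weight above `t` every syndrome would have at most one error and the two
distributions would coincide. The remaining amplitudes perturb both by at most `2 η + η²` in `ℓ¹`,
where `η` is their total absolute value (`sum_abs_coarse_sub_le`), and a Chernoff bound with
weight `e²` per error gives `η ≤ e^{-α n}` (`sum_norm_errorAmp_tail_le`). This uses only
`|sin θ| ≤ α / e²`, which the bound on `θ` implies.
-/

/-! ### Processing samples -/

theorem zmod_two_cases (b : ZMod 2) : b = 0 ∨ b = 1 := by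
  revert b; decide

theorem runSteps_append (p q : List SamplerStep) (w : List (ZMod 2)) :
    runSteps (p ++ q) w = (runSteps p w).bind (runSteps q) := by
  induction p generalizing w with
  | nil => simp [runSteps]
  | cons s p ih =>
    cases s with
    | coin => simp [runSteps, ih]
    | gate f i j => simp [runSteps, ih]

theorem length_of_mem_support_runSteps {p : List SamplerStep} {w v : List (ZMod 2)}
    (h : v ∈ (runSteps p w).support) : v.length = w.length + p.length := by
  induction p generalizing w with
  | nil => simp_all [runSteps]
  | cons s p ih =>
    cases s with
    | coin =>
      simp only [runSteps, PMF.mem_support_bind_iff] at h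
      obtain ⟨r, -, h⟩ := h
      simp [ih h]; omega
    | gate f i j =>
      simp [ih h]; omega

theorem PMF.bind_congr_support {α β : Type*} (p : PMF α) {f g : α → PMF β}
    (h : ∀ a ∈ p.support, f a = g a) : p.bind f = p.bind g := by
  ext b
  simp only [PMF.bind_apply]
  refine tsum_congr fun a => ?_
  by_cases ha : a ∈ p.support
  · rw [h a ha]
  · simp [(PMF.apply_eq_zero_iff p a).2 ha]

theorem PMF.toReal_bind_apply {α β : Type*} [Fintype α] (p : PMF α) (K : α → PMF β) (b : β) :
    (p.bind K b).toReal = ∑ a, (p a).toReal * (K a b).toReal := by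
  rw [PMF.bind_apply, tsum_fintype, ENNReal.toReal_sum]
  · simp
  · intro a _
    exact ENNReal.mul_ne_top (PMF.apply_ne_top p a) (PMF.apply_ne_top _ b)

theorem PMF.sum_toReal {α : Type*} [Fintype α] (p : PMF α) : ∑ a, (p a).toReal = 1 := by
  rw [← ENNReal.toReal_sum fun a _ => PMF.apply_ne_top p a, ← tsum_fintype (L := .unconditional _),
    p.tsum_coe, ENNReal.toReal_one]

/-- Applying a stochastic map to two weight functions does not increase their distance. -/
theorem tvDist_push_le {X Y : Type*} [Fintype X] [Fintype Y] (K : X → PMF Y) (P Q : X → ℝ) :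
    tvDist (fun y => ∑ x, P x * (K x y).toReal) (fun y => ∑ x, Q x * (K x y).toReal)
      ≤ tvDist P Q := by
  unfold tvDist
  refine mul_le_mul_of_nonneg_left ?_ (by norm_num)
  calc ∑ y, |∑ x, P x * (K x y).toReal - ∑ x, Q x * (K x y).toReal|
      ≤ ∑ y, ∑ x, |P x - Q x| * (K x y).toReal := by
        refine Finset.sum_le_sum fun y _ => ?_
        rw [← Finset.sum_sub_distrib]
        refine (Finset.abs_sum_le_sum_abs _ _).trans_eq (Finset.sum_congr rfl fun x _ => ?_)
        rw [← sub_mul, abs_mul, abs_of_nonneg (ENNReal.toReal_nonneg (a := K x y))]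
    _ = ∑ x, |P x - Q x| := by
        rw [Finset.sum_comm]
        simp [← Finset.mul_sum, PMF.sum_toReal]

theorem tvDist_triangle {X : Type*} [Fintype X] (P Q R : X → ℝ) :
    tvDist P R ≤ tvDist P Q + tvDist Q R := by
  unfold tvDist
  rw [← mul_add, ← Finset.sum_add_distrib]
  exact mul_le_mul_of_nonneg_left (Finset.sum_le_sum fun x _ => abs_sub_le _ _ _) (by norm_num)

theorem tvDist_comm {X : Type*} [Fintype X] (P Q : X → ℝ) : tvDist P Q = tvDist Q P := by
  simp [tvDist, abs_sub_comm]

theorem tvDist_nonneg {X : Type*} [Fintype X] (P Q : X → ℝ) : 0 ≤ tvDist P Q := by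
  unfold tvDist; positivity

/-- Some sampler produces `D` up to total variation distance `δ`. -/
def Samplable {κ : Type*} [Fintype κ] [DecidableEq κ] (δ : ℝ) (D : (κ → ZMod 2) → ℝ) : Prop :=
  ∃ A : Sampler κ, tvDist (fun x => (A.dist x).toReal) D ≤ δ

section
variable {κ κ' : Type*}

theorem samplingTime_le [Fintype κ] [DecidableEq κ] {δ : ℝ} {D : (κ → ZMod 2) → ℝ} (A : Sampler κ)
    (hA : tvDist (fun x => (A.dist x).toReal) D ≤ δ) : samplingTime δ D ≤ A.time :=
  Nat.sInf_le ⟨A, rfl, hA⟩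

theorem Samplable.exists_time_eq [Fintype κ] [DecidableEq κ] {δ : ℝ} {D : (κ → ZMod 2) → ℝ}
    (h : Samplable δ D) :
    ∃ A : Sampler κ, A.time = samplingTime δ D ∧ tvDist (fun x => (A.dist x).toReal) D ≤ δ := by
  obtain ⟨A, hA⟩ := h
  exact Nat.sInf_mem (s := {T | ∃ A : Sampler κ, A.time = T ∧
    tvDist (fun x => (A.dist x).toReal) D ≤ δ}) ⟨_, A, rfl, hA⟩

theorem samplable_of_samplingTime_pos [Fintype κ] [DecidableEq κ] {δ : ℝ} {D : (κ → ZMod 2) → ℝ}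
    (h : 0 < samplingTime δ D) : Samplable δ D := by
  obtain ⟨-, A, -, hA⟩ := Nat.nonempty_of_pos_sInf h
  exact ⟨A, hA⟩

/-- If samples from `D` can be turned into samples from `D'` by at most `m` further steps that
implement the stochastic map `K`, then sampling `D'` costs at most `m` steps more than `D`. -/
theorem Samplable.push [Fintype κ] [DecidableEq κ] [Fintype κ'] [DecidableEq κ']
    {δ : ℝ} {D : (κ → ZMod 2) → ℝ} {D' : (κ' → ZMod 2) → ℝ}
    (h : Samplable δ D) (K : (κ → ZMod 2) → PMF (κ' → ZMod 2)) (m : ℕ)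
    (hK : ∀ A : Sampler κ, ∃ B : Sampler κ', B.time ≤ A.time + m ∧ B.dist = A.dist.bind K)
    (hD : ∀ y, D' y = ∑ x, D x * (K x y).toReal) :
    Samplable δ D' ∧ samplingTime δ D' ≤ samplingTime δ D + m := by
  obtain ⟨A, hAt, hA⟩ := h.exists_time_eq
  obtain ⟨B, hBt, hB⟩ := hK A
  have hBd : tvDist (fun x => (B.dist x).toReal) D' ≤ δ := by
    rw [hB, funext hD]
    simp only [PMF.toReal_bind_apply]
    exact (tvDist_push_le K _ _).trans hA
  exact ⟨⟨B, hBd⟩, (samplingTime_le B hBd).trans (hAt ▸ hBt)⟩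

theorem PMF.toReal_pure_apply {α : Type*} [DecidableEq α] (a b : α) :
    (PMF.pure a b).toReal = if b = a then 1 else 0 := by
  rw [PMF.pure_apply]; split_ifs <;> simp

theorem samplingTime_add_tvDist_le [Fintype κ] [DecidableEq κ] {δ : ℝ} {D D' : (κ → ZMod 2) → ℝ}
    (h : Samplable δ D) :
    samplingTime (δ + tvDist D' D) D' ≤ samplingTime δ D := by
  obtain ⟨A, hAt, hA⟩ := h.exists_time_eq
  rw [← hAt]
  refine samplingTime_le A ((tvDist_triangle _ D _).trans ?_)
  rw [tvDist_comm D' D]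
  gcongr

/-- The sum over `𝔽₂` of the listed memory cells, one gate per cell. -/
theorem exists_xor_steps (L : ℕ) (c : List ℕ) (hc : ∀ i ∈ c, i < L) :
    ∃ q : List SamplerStep, q.length = c.length + 1 ∧ ∀ w : List (ZMod 2), w.length = L →
      ∃ v : List (ZMod 2), v.length = q.length ∧ runSteps q w = PMF.pure (w ++ v) ∧
        (w ++ v).getD (L + c.length) 0 = (c.map fun i => w.getD i 0).sum := by
  induction c using List.reverseRecOn with
  | nil =>
    exact ⟨[SamplerStep.gate (fun _ _ => 0) 0 0], rfl, fun w hw =>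
      ⟨[0], rfl, by simp [runSteps], by simp [← hw]⟩⟩
  | append_singleton c a ih =>
    obtain ⟨q, hq, h⟩ := ih fun i hi => hc i (by simp [hi])
    refine ⟨q ++ [SamplerStep.gate (· + ·) (L + c.length) a], by simp [hq], fun w hw => ?_⟩
    obtain ⟨v, hv, hr, hs⟩ := h w hw
    have ha : a < w.length := hw ▸ hc a (by simp)
    refine ⟨v ++ [(w ++ v).getD (L + c.length) 0 + (w ++ v).getD a 0], by simp [hv], ?_, ?_⟩
    · rw [runSteps_append, hr, PMF.pure_bind]
      simp [runSteps]
    · have hl : L + (c ++ [a]).length = (w ++ v).length := by simp [hw, hv, hq]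
      rw [hl, ← List.append_assoc, List.getD_append_right _ _ _ _ le_rfl, hs,
        List.getD_append _ _ _ _ ha]
      simp

/-- Several sums over `𝔽₂` of memory cells, computed one after the other; `s` is the set of sums
that are already available. -/
theorem exists_xor_steps_family [DecidableEq κ'] (L N : ℕ) (c : κ' → List ℕ)
    (hc : ∀ j, ∀ i ∈ c j, i < L)
    (hN : ∀ j, (c j).length ≤ N) (s : Finset κ') :
    ∃ (q : List SamplerStep) (out : κ' → ℕ), q.length ≤ s.card * (N + 1) ∧
      ∀ w : List (ZMod 2), w.length = L →
        ∃ v : List (ZMod 2), v.length = q.length ∧ runSteps q w = PMF.pure (w ++ v) ∧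
          ∀ j ∈ s, out j < L + q.length ∧
            (w ++ v).getD (out j) 0 = ((c j).map fun i => w.getD i 0).sum := by
  induction s using Finset.induction_on with
  | empty => exact ⟨[], fun _ => 0, by simp, fun w _ => ⟨[], rfl, by simp [runSteps], by simp⟩⟩
  | insert a s ha ih =>
    obtain ⟨q, out, hq, h⟩ := ih
    obtain ⟨q', hq', h'⟩ := exists_xor_steps (L + q.length) (c a)
      fun i hi => (hc a i hi).trans_le (Nat.le_add_right _ _)
    refine ⟨q ++ q', Function.update out a (L + q.length + (c a).length), ?_, fun w hw => ?_⟩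
    · rw [Finset.card_insert_of_notMem ha, List.length_append, hq', add_mul, one_mul]
      have := hN a
      omega
    · obtain ⟨v, hv, hr, hs⟩ := h w hw
      obtain ⟨v', hv', hr', hs'⟩ := h' (w ++ v) (by simp [hw, hv])
      refine ⟨v ++ v', by simp [hv, hv'], ?_, fun j hj => ?_⟩
      · rw [runSteps_append, hr, PMF.pure_bind, hr', List.append_assoc]
      · rw [← List.append_assoc]
        by_cases hja : j = a
        · subst hja
          rw [Function.update_self, hs']
          refine ⟨by simp [hq']; omega, congrArg List.sum (List.map_congr_left fun i hi => ?_)⟩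
          exact List.getD_append _ _ _ _ (hw ▸ hc j i hi)
        · obtain ⟨ho, hs⟩ := hs j ((Finset.mem_insert.1 hj).resolve_left hja)
          rw [Function.update_of_ne hja, List.getD_append _ _ _ _ (by simp [hw, hv, ho]), hs]
          exact ⟨by simp; omega, rfl⟩

/-- A linear map over `𝔽₂` can be applied to the output of a sampler by quadratically many
gates. -/
theorem Sampler.exists_map_mulVec [Fintype κ] [Fintype κ'] [DecidableEq κ']
    (M : Matrix κ' κ (ZMod 2)) (A : Sampler κ) :
    ∃ B : Sampler κ', B.time ≤ A.time + Fintype.card κ' * (Fintype.card κ + 1) ∧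
      B.dist = A.dist.bind fun x => PMF.pure (M.mulVec x) := by
  -- Cells that `A` never writes read as `0`; they are left out, as later steps may write them.
  let S : κ' → Finset κ := fun j => Finset.univ.filter fun i => M j i = 1 ∧ A.out i < A.time
  obtain ⟨q, out, hq, h⟩ := exists_xor_steps_family A.time (Fintype.card κ)
    (fun j => (S j).toList.map A.out) (by intro j i hi; simp [S] at hi; grind)
    (fun j => by simpa using Finset.card_le_univ (S j)) (Finset.univ : Finset κ')
  refine ⟨⟨A.steps ++ q, out⟩, ?_, ?_⟩
  · simpa [Sampler.time] using hq
  · simp only [Sampler.dist, runSteps_append, ← PMF.bind_pure_comp, PMF.bind_bind]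
    refine PMF.bind_congr_support _ fun w hw => ?_
    have hl : w.length = A.time := by
      simpa [Sampler.time] using length_of_mem_support_runSteps hw
    obtain ⟨v, hv, hr, hs⟩ := h w hl
    simp only [hr, PMF.pure_bind, Function.comp]
    congr 1
    ext j
    rw [(hs j (Finset.mem_univ j)).2, List.map_map, Finset.sum_map_toList, Finset.sum_filter,
      Matrix.mulVec, dotProduct]
    refine Finset.sum_congr rfl fun i _ => ?_
    by_cases hi : A.out i < A.time
    · rcases zmod_two_cases (M j i) with h0 | h0 <;> simp [h0, hi]
    · rw [List.getD_eq_default _ _ (by omega)]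
      simp [hi]

/-- Output bits can be dropped at no cost. -/
theorem Sampler.exists_map_comp (f : κ' → κ) (A : Sampler κ) :
    ∃ B : Sampler κ', B.time ≤ A.time + 0 ∧
      B.dist = A.dist.bind fun x => PMF.pure (x ∘ f) := by
  refine ⟨⟨A.steps, A.out ∘ f⟩, le_rfl, ?_⟩
  simp only [Sampler.dist, ← PMF.bind_pure_comp, PMF.bind_bind, PMF.pure_bind, Function.comp]
  rfl

end

theorem runSteps_replicate_coin (m : ℕ) (w : List (ZMod 2)) :
    runSteps (List.replicate m SamplerStep.coin) w =
      (PMF.uniformOfFintype (Fin m → ZMod 2)).map fun r => w ++ List.ofFn r := by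
  induction m generalizing w with
  | zero =>
    simp only [List.replicate, runSteps, List.ofFn_zero, List.append_nil]
    exact (PMF.map_const _ _).symm
  | succ m ih =>
    have hu : PMF.uniformOfFintype (Fin (m + 1) → ZMod 2) =
        (PMF.uniformOfFintype (ZMod 2)).bind fun r =>
          (PMF.uniformOfFintype (Fin m → ZMod 2)).bind fun r' => PMF.pure (Fin.cons r r') := by
      ext y
      simp only [PMF.bind_apply, PMF.uniformOfFintype_apply, PMF.pure_apply, tsum_fintype]
      rw [Finset.sum_eq_single (y 0), Finset.sum_eq_single (Fin.tail y)]
      · rw [if_pos (Fin.cons_self_tail y).symm]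
        simp [pow_succ, ENNReal.mul_inv, mul_comm]
      · intro r' _ hr'
        rw [if_neg, mul_zero]
        intro h
        exact hr' (by rw [h, Fin.tail_cons])
      · simp
      · intro r _ hr
        rw [Finset.sum_eq_zero, mul_zero]
        intro r' _
        rw [if_neg, mul_zero]
        intro h
        exact hr (by rw [h, Fin.cons_zero])
      · simp
    rw [List.replicate_succ, runSteps, hu]
    simp only [PMF.map_bind, ih, PMF.pure_map]
    simp [← PMF.bind_pure_comp, Function.comp_def]

/-- The bits outside `T` are filled with fair coins. -/
noncomputable def coinFill {n : ℕ} (T : Finset (Fin n)) (z : T → ZMod 2) : PMF (Fin n → ZMod 2) :=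
  (PMF.uniformOfFintype (Fin n → ZMod 2)).bind fun r =>
    PMF.pure fun j => if h : j ∈ T then z ⟨j, h⟩ else r j

theorem Sampler.exists_bind_coinFill {n : ℕ} (T : Finset (Fin n)) (A : Sampler T) :
    ∃ B : Sampler (Fin n), B.time ≤ A.time + n ∧ B.dist = A.dist.bind (coinFill T) := by
  -- Cells that `A` never writes are replaced by one that the extended program never writes.
  refine ⟨⟨A.steps ++ List.replicate n SamplerStep.coin, fun j => if h : j ∈ T then
    (if A.out ⟨j, h⟩ < A.time then A.out ⟨j, h⟩ else A.time + n) else A.time + j⟩,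
    by simp [Sampler.time], ?_⟩
  simp only [Sampler.dist, runSteps_append, ← PMF.bind_pure_comp, PMF.bind_bind,
    coinFill, PMF.pure_bind, Function.comp, runSteps_replicate_coin]
  refine PMF.bind_congr_support _ fun w hw => ?_
  have hl : w.length = A.time := by
    simpa [Sampler.time] using length_of_mem_support_runSteps hw
  congr 1
  ext1 r
  congr 1
  ext j
  by_cases hj : j ∈ T
  · by_cases ho : A.out ⟨j, hj⟩ < A.time
    · simp only [hj, ho, dif_pos, if_pos]
      rw [List.getD_append _ _ _ _ (by omega)]
    · simp only [hj, ho, dif_pos, if_false]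
      rw [List.getD_eq_default _ _ (by simp [hl]), List.getD_eq_default _ _ (by omega)]
  · simp only [hj, dif_neg, not_false_eq_true]
    rw [List.getD_append_right _ _ _ _ (by omega)]
    simp [hl]

/-! ### Outcome distributions of the rotated states -/

/-- The character `(-1)^b` of `𝔽₂`. -/
def bitSign (b : ZMod 2) : ℂ := if b = 0 then 1 else -1

theorem bitSign_add (a b : ZMod 2) : bitSign (a + b) = bitSign a * bitSign b := by
  rcases zmod_two_cases a with rfl | rfl <;> rcases zmod_two_cases b with rfl | rfl <;>
    simp [bitSign, show (1 : ZMod 2) + 1 = 0 from rfl]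

theorem bitSign_sum {ι : Type*} (s : Finset ι) (f : ι → ZMod 2) :
    bitSign (∑ i ∈ s, f i) = ∏ i ∈ s, bitSign (f i) := by
  classical
  induction s using Finset.induction_on with
  | empty => simp [bitSign]
  | insert a s ha ih => rw [Finset.sum_insert ha, Finset.prod_insert ha, bitSign_add, ih]

theorem sum_zmod_two {M : Type*} [AddCommMonoid M] (f : ZMod 2 → M) : ∑ b, f b = f 0 + f 1 :=
  Fin.sum_univ_two f

theorem pauliZ_pow_val (b : ZMod 2) :
    pauliZ ^ b.val = Matrix.diagonal fun w => bitSign (b * w) := by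
  rcases zmod_two_cases b with rfl | rfl
  · simp [bitSign]
  · simp [pauliZ, bitSign, ZMod.val_one]

theorem tensorOp_diagonal {n : ℕ} (d : Fin n → ZMod 2 → ℂ) :
    tensorOp (fun i => Matrix.diagonal (d i)) = Matrix.diagonal fun w => ∏ i, d i (w i) := by
  ext x y
  by_cases h : x = y
  · subst h; simp [tensorOp]
  · obtain ⟨i, hi⟩ := Function.ne_iff.1 h
    rw [Matrix.diagonal_apply_ne _ h]
    exact Finset.prod_eq_zero (Finset.mem_univ i) (Matrix.diagonal_apply_ne _ hi)

theorem pauliZString_eq_diagonal {n : ℕ} (v : Fin n → ZMod 2) :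
    pauliZString v = Matrix.diagonal fun w => bitSign (v ⬝ᵥ w) := by
  simp only [pauliZString, pauliZ_pow_val, tensorOp_diagonal, dotProduct, bitSign_sum]

/-- The eigenvalue of `U(θ)` on the computational basis state `|u⟩`. -/
noncomputable def zPhase {n : ℕ} (θ : ℝ) (u : Fin n → ZMod 2) : ℂ :=
  ∏ i, Complex.exp (Complex.I * θ * bitSign (u i))

theorem coherentError_mulVec {n : ℕ} (θ : ℝ) (ψ : QState n) (w : Fin n → ZMod 2) :
    (coherentError n θ).mulVec ψ w = zPhase θ w * ψ w := by
  have h : NormedSpace.exp ((Complex.I * (θ : ℂ)) • pauliZ)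
      = Matrix.diagonal fun b => Complex.exp (Complex.I * θ * bitSign b) := by
    rw [pauliZ, ← Matrix.diagonal_smul, Matrix.exp_diagonal]
    congr 1
    ext b
    rw [Pi.coe_exp, ← Complex.exp_eq_exp_ℂ]
    rfl
  rw [coherentError, h, tensorOp_diagonal, Matrix.mulVec_diagonal, zPhase]

theorem zRotation_mulVec {n : ℕ} (θ : ℝ) (V : Matrix (Fin n) (Fin n) (ZMod 2)) (ψ : QState n)
    (w : Fin n → ZMod 2) :
    (zRotation θ V).mulVec ψ w = zPhase θ (V.mulVec w) * ψ w := by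
  have h : (Complex.I * (θ : ℂ)) • ∑ i, pauliZString (V i)
      = Matrix.diagonal fun w => ∑ i, Complex.I * θ * bitSign (V.mulVec w i) := by
    ext x y
    by_cases hxy : x = y
    · subst hxy
      simp [pauliZString_eq_diagonal, Matrix.sum_apply, Finset.mul_sum, Matrix.mulVec]
    · simp [pauliZString_eq_diagonal, Matrix.sum_apply, hxy]
  rw [zRotation, h, Matrix.exp_diagonal, Matrix.mulVec_diagonal, Pi.coe_exp,
    ← Complex.exp_eq_exp_ℂ, Complex.exp_sum, zPhase]

theorem bra_X_apply (b w : ZMod 2) :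
    PauliAxis.X.bra b w = (1 / (Real.sqrt 2 : ℂ)) * bitSign (b * w) := by
  rcases zmod_two_cases b with rfl | rfl <;> rcases zmod_two_cases w with rfl | rfl <;>
    simp [PauliAxis.bra, bitSign]

/-- `X`-basis outcome probabilities are given by the Fourier transform over `𝔽₂ⁿ`. -/
theorem pauliMeasure_X {n : ℕ} (ψ : QState n) (x : Fin n → ZMod 2) :
    pauliMeasure (fun _ => PauliAxis.X) ψ x
      = ((1 / 2 : ℝ)) ^ n * ‖∑ w, bitSign (x ⬝ᵥ w) * ψ w‖ ^ 2 := by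
  have h : (tensorOp fun _ : Fin n => PauliAxis.X.bra).mulVec ψ x
      = (1 / (Real.sqrt 2 : ℂ)) ^ n * ∑ w, bitSign (x ⬝ᵥ w) * ψ w := by
    simp only [Matrix.mulVec, dotProduct, tensorOp, Matrix.of_apply, bra_X_apply,
      Finset.prod_mul_distrib, Finset.prod_const, Finset.card_univ, Fintype.card_fin, bitSign_sum,
      Finset.mul_sum, mul_assoc]
  rw [pauliMeasure, h, norm_mul, mul_pow, norm_pow, ← pow_mul, mul_comm n 2, pow_mul]
  congr 2
  simp

/-- The amplitude of the error `Z^e` in the expansion `U(θ) = ∑ₑ a(e) Z^e`. -/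
noncomputable def errorAmp {n : ℕ} (θ : ℝ) (e : Fin n → ZMod 2) : ℂ :=
  ∏ i, if e i = 0 then (Real.cos θ : ℂ) else Complex.I * Real.sin θ

theorem zPhase_eq_sum {n : ℕ} (θ : ℝ) (u : Fin n → ZMod 2) :
    zPhase θ u = ∑ e : Fin n → ZMod 2, errorAmp θ e * bitSign (e ⬝ᵥ u) := by
  have h : ∀ b : ZMod 2, Complex.exp (Complex.I * θ * bitSign b)
      = ∑ d : ZMod 2, (if d = 0 then (Real.cos θ : ℂ) else Complex.I * Real.sin θ)
          * bitSign (d * b) := by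
    intro b
    rw [sum_zmod_two]
    rcases zmod_two_cases b with rfl | rfl
    · simp [bitSign, mul_comm Complex.I, Complex.exp_mul_I]
    · have : Complex.I * (θ : ℂ) * -1 = (-θ : ℂ) * Complex.I := by ring
      simp only [bitSign, one_ne_zero, if_false, this, Complex.exp_mul_I]
      simp [mul_comm Complex.I]
  simp only [zPhase, h, errorAmp, dotProduct, bitSign_sum, ← Finset.prod_mul_distrib]
  exact Fintype.prod_sum _

theorem sum_bitSign_mul_plusZeroState {n : ℕ} (S : Finset (Fin n)) (u : Fin n → ZMod 2) :
    ∑ w : Fin n → ZMod 2, bitSign (u ⬝ᵥ w) * plusZeroState S w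
      = if ∀ j ∈ S, u j = 0 then (Real.sqrt 2 : ℂ) ^ S.card else 0 := by
  have h : ∀ w : Fin n → ZMod 2, bitSign (u ⬝ᵥ w) * plusZeroState S w
      = ∏ i, bitSign (u i * w i) *
        (if i ∈ S then (1 / (Real.sqrt 2 : ℂ)) else if w i = 0 then 1 else 0) := by
    intro w
    rw [dotProduct, bitSign_sum, plusZeroState, ← Finset.prod_mul_distrib]
  have h2 : ∀ i, ∑ b : ZMod 2, bitSign (u i * b) *
      (if i ∈ S then (1 / (Real.sqrt 2 : ℂ)) else if b = 0 then 1 else 0)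
      = if i ∈ S then (if u i = 0 then (Real.sqrt 2 : ℂ) else 0) else 1 := by
    intro i
    have hs : (1 / (Real.sqrt 2 : ℂ)) + 1 / (Real.sqrt 2 : ℂ) = (Real.sqrt 2 : ℂ) := by
      have : (Real.sqrt 2 : ℂ) * Real.sqrt 2 = 2 := by
        rw [← Complex.ofReal_mul, Real.mul_self_sqrt (by norm_num)]; norm_num
      have h0 : (Real.sqrt 2 : ℂ) ≠ 0 := by
        intro h; simp [h] at this
      field_simp
      rw [sq, this]; norm_num
    rw [sum_zmod_two]
    by_cases hi : i ∈ S
    · rcases zmod_two_cases (u i) with hu | hu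
      · simpa [hi, hu, bitSign] using hs
      · simp [hi, hu, bitSign]
    · simp [hi, bitSign]
  simp only [h]
  rw [← Fintype.prod_sum fun i b => bitSign (u i * b) *
      (if i ∈ S then (1 / (Real.sqrt 2 : ℂ)) else if b = 0 then 1 else 0)]
  simp only [h2]
  rw [Finset.prod_ite_mem, Finset.univ_inter]
  split_ifs with hu
  · rw [Finset.prod_congr rfl fun i hi => if_pos (hu i hi), Finset.prod_const]
  · push Not at hu
    obtain ⟨j, hj, hu⟩ := hu
    exact Finset.prod_eq_zero hj (if_neg hu)

/-- Total amplitude of the errors whose image under `Vᵀ` takes the values `z` on `S`. -/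
noncomputable def classAmp {n : ℕ} (θ : ℝ) (V : Matrix (Fin n) (Fin n) (ZMod 2))
    (S : Finset (Fin n)) (z : S → ZMod 2) : ℂ :=
  ∑ e : Fin n → ZMod 2, if (fun j : S => V.transpose.mulVec e j) = z then errorAmp θ e else 0

/-- Outcomes that agree on the qubits in `|+⟩` are equally likely; their probability is the square
of the total amplitude of the errors that produce them. -/
theorem rotatedInstance_dist_X {n : ℕ} (θ : ℝ) (V : Matrix (Fin n) (Fin n) (ZMod 2))
    (S : Finset (Fin n)) (y : Fin n → ZMod 2) :
    (⟨n, V, S, fun _ => PauliAxis.X⟩ : RotatedInstance).dist θ y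
      = (1 / 2 : ℝ) ^ n * 2 ^ S.card * ‖classAmp θ V S fun j => y j‖ ^ 2 := by
  have hdot : ∀ e w : Fin n → ZMod 2, e ⬝ᵥ V.mulVec w = V.transpose.mulVec e ⬝ᵥ w := by
    intro e w
    rw [Matrix.dotProduct_mulVec, Matrix.mulVec_transpose]
  have hsum : ∑ w, bitSign (y ⬝ᵥ w) * (zRotation θ V).mulVec (plusZeroState S) w
      = (Real.sqrt 2 : ℂ) ^ S.card * classAmp θ V S fun j => y j := by
    simp only [zRotation_mulVec, zPhase_eq_sum, hdot, Finset.sum_mul, Finset.mul_sum]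
    rw [Finset.sum_comm, classAmp, Finset.mul_sum]
    refine Finset.sum_congr rfl fun e _ => ?_
    have : ∀ w, bitSign (y ⬝ᵥ w) * (errorAmp θ e * bitSign (V.transpose.mulVec e ⬝ᵥ w)
        * plusZeroState S w) = errorAmp θ e *
          (bitSign ((y + V.transpose.mulVec e) ⬝ᵥ w) * plusZeroState S w) := by
      intro w
      rw [add_dotProduct, bitSign_add]; ring
    simp only [this]
    rw [← Finset.mul_sum, sum_bitSign_mul_plusZeroState]
    have hiff : (∀ j ∈ S, (y + V.transpose.mulVec e) j = 0) ↔
        (fun j : S => V.transpose.mulVec e j) = fun j : S => y j := by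
      simp only [funext_iff, Subtype.forall, Pi.add_apply]
      refine forall₂_congr fun j _ => ?_
      rw [← CharTwo.sub_eq_add, sub_eq_zero, eq_comm]
    simp only [hiff]
    split_ifs <;> ring
  rw [RotatedInstance.dist, pauliMeasure_X, hsum, norm_mul, mul_pow, norm_pow, ← pow_mul,
    mul_comm S.card 2, pow_mul]
  simp [mul_assoc]

/-! ### Code states and syndromes -/

/-- A linear map that takes the coordinate subspace on `S` to `C` takes the corresponding product
state to the subspace state of `C`. -/
theorem subspaceState_mulVec {n : ℕ} {V : Matrix (Fin n) (Fin n) (ZMod 2)} (hV : IsUnit V)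
    {S : Finset (Fin n)} {C : Submodule (ZMod 2) (Fin n → ZMod 2)}
    (hC : Submodule.span (ZMod 2) ((fun j i => V i j) '' (S : Set (Fin n))) = C)
    (w : Fin n → ZMod 2) : subspaceState C (V.mulVec w) = plusZeroState S w := by
  have hinj : Function.Injective V.mulVec := Matrix.mulVec_injective_iff_isUnit.2 hV
  have hmem : V.mulVec w ∈ C ↔ ∀ j ∉ S, w j = 0 := by
    constructor
    · intro h
      have hle : C ≤ (Submodule.pi (S : Set (Fin n))ᶜ fun _ => (⊥ : Submodule (ZMod 2) (ZMod 2))).map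
          V.mulVecLin := by
        rw [← hC, Submodule.span_le]
        rintro _ ⟨j, hj, rfl⟩
        refine ⟨Pi.single j 1, ?_, ?_⟩
        · intro i hi
          have : i ≠ j := by rintro rfl; exact hi hj
          simp [this]
        · ext i; simp
      obtain ⟨w', hw', hww⟩ := hle h
      rw [← hinj hww]
      intro j hj
      simpa using hw' j (by simpa using hj)
    · intro h
      rw [Matrix.mulVec_eq_sum]
      refine Submodule.sum_mem _ fun j _ => ?_
      by_cases hj : j ∈ S
      · rw [← hC]
        have hcol : (fun i => V i j) ∈ Submodule.span (ZMod 2)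
            ((fun j i => V i j) '' (S : Set (Fin n))) :=
          Submodule.subset_span (Set.mem_image_of_mem _ hj)
        rw [op_smul_eq_smul]
        exact Submodule.smul_mem _ _ hcol
      · simp [h j hj]
  have hcard : Nat.card C = 2 ^ S.card := by
    have hli : LinearIndependent (ZMod 2) fun j : S => V.col j :=
      (Matrix.linearIndependent_cols_iff_isUnit.2 hV).comp _ Subtype.val_injective
    have hr : Set.range (fun j : S => V.col j) = (fun j i => V i j) '' (S : Set (Fin n)) := by
      rw [Set.image_eq_range]; rfl
    have hf : Module.finrank (ZMod 2) C = S.card := by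
      rw [← hC, ← hr, finrank_span_eq_card hli, Fintype.card_coe]
    rw [Module.natCard_eq_pow_finrank (K := ZMod 2), hf, Nat.card_zmod]
  have hsq : (Real.sqrt (2 ^ S.card : ℝ)) = Real.sqrt 2 ^ S.card := by
    rw [Real.sqrt_eq_iff_mul_self_eq (by positivity) (by positivity), ← mul_pow,
      Real.mul_self_sqrt (by norm_num)]
  rw [subspaceState, plusZeroState, hcard]
  split_ifs with h
  · rw [hmem] at h
    rw [Finset.prod_congr rfl (g := fun i => if i ∈ S then (1 / (Real.sqrt 2 : ℂ)) else 1)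
      fun i _ => ?_]
    · push_cast
      rw [hsq, Finset.prod_ite_mem, Finset.univ_inter, Finset.prod_const]
      simp
    · by_cases hi : i ∈ S
      · simp [hi]
      · simp [hi, h i hi]
  · rw [hmem] at h
    push Not at h
    obtain ⟨j, hj, hw⟩ := h
    exact (Finset.prod_eq_zero (Finset.mem_univ j) (by simp [hj, hw])).symm

/-- Unencoding turns the `X`-basis outcomes of a code state that suffered the coherent error into
the outcomes of the rotated product state. -/
theorem outcomeDist_subspaceState (Q : CSSCode) (θ : ℝ)
    {V : Matrix (Fin Q.n) (Fin Q.n) (ZMod 2)} (hV : IsUnit V)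
    {S : Finset (Fin Q.n)} {C : Submodule (ZMod 2) (Fin Q.n → ZMod 2)}
    (hC : Submodule.span (ZMod 2) ((fun j i => V i j) '' (S : Set (Fin Q.n))) = C)
    (x : Fin Q.n → ZMod 2) :
    Q.outcomeDist θ (subspaceState C) x
      = (⟨Q.n, V, S, fun _ => PauliAxis.X⟩ : RotatedInstance).dist θ (V.transpose.mulVec x) := by
  have hbij : Function.Bijective V.mulVec :=
    Finite.injective_iff_bijective.1 (Matrix.mulVec_injective_iff_isUnit.2 hV)
  rw [CSSCode.outcomeDist, RotatedInstance.dist, pauliMeasure_X, pauliMeasure_X,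
    ← hbij.sum_comp]
  simp only [coherentError_mulVec, subspaceState_mulVec hV hC, zRotation_mulVec,
    Matrix.dotProduct_mulVec, Matrix.mulVec_transpose]

theorem bijective_transpose_mulVec {n : ℕ} {V : Matrix (Fin n) (Fin n) (ZMod 2)} (hV : IsUnit V) :
    Function.Bijective V.transpose.mulVec :=
  Finite.injective_iff_bijective.1
    (Matrix.mulVec_injective_iff_isUnit.2 ((Matrix.isUnit_transpose V).2 hV))

theorem sum_comp_restrict {n : ℕ} (S : Finset (Fin n)) (g : (S → ZMod 2) → ℝ) :
    ∑ y : Fin n → ZMod 2, g (fun j => y j) = 2 ^ (n - S.card) * ∑ z, g z := by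
  rw [← (Equiv.piEquivPiSubtypeProd (fun j => j ∈ S) fun _ => ZMod 2).symm.sum_comp,
    Fintype.sum_prod_type, Finset.mul_sum]
  refine Finset.sum_congr rfl fun z _ => ?_
  have : ∀ z', (fun j : S => (Equiv.piEquivPiSubtypeProd (fun j => j ∈ S)
      fun _ => ZMod 2).symm (z, z') j) = z := by
    intro z'; ext j; simp [Equiv.piEquivPiSubtypeProd]
  simp only [this]
  simp [Fintype.card_subtype_compl]

theorem half_pow_mul {n m : ℕ} (h : m ≤ n) : (1 / 2 : ℝ) ^ n * 2 ^ m * 2 ^ (n - m) = 1 := by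
  rw [mul_assoc, ← pow_add, Nat.add_sub_cancel' h, ← mul_pow]; norm_num

/-- Given its syndrome, the state with `|+⟩` exactly on the syndrome register has uniform
outcomes on all other qubits. -/
theorem rotatedInstance_dist_eq_coinFill {n : ℕ} (θ : ℝ) (V : Matrix (Fin n) (Fin n) (ZMod 2))
    (T : Finset (Fin n)) (y : Fin n → ZMod 2) :
    (⟨n, V, T, fun _ => PauliAxis.X⟩ : RotatedInstance).dist θ y
      = ∑ s : T → ZMod 2, ‖classAmp θ V T s‖ ^ 2 * (coinFill T s y).toReal := by
  have hfill : ∀ s : T → ZMod 2, (coinFill T s y).toReal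
      = if s = (fun j : T => y j) then (1 / 2 : ℝ) ^ n * 2 ^ T.card else 0 := by
    intro s
    have hr : ∀ r : Fin n → ZMod 2, (y = fun j => if h : j ∈ T then s ⟨j, h⟩ else r j) ↔
        s = (fun j : T => y j) ∧
          (fun j : (Tᶜ : Finset (Fin n)) => r j) = fun j : (Tᶜ : Finset (Fin n)) => y j := by
      intro r
      simp only [funext_iff, Subtype.forall, Finset.mem_compl]
      constructor
      · intro h
        exact ⟨fun j hj => by simp [h j, hj], fun j hj => by simp [h j, hj]⟩
      · rintro ⟨h1, h2⟩ j
        by_cases hj : j ∈ T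
        · simp [hj, h1 j hj]
        · simp [hj, h2 j hj]
    rw [coinFill, PMF.toReal_bind_apply]
    simp only [PMF.toReal_pure_apply, hr, PMF.uniformOfFintype_apply]
    by_cases hs : s = fun j : T => y j
    · simp only [hs, true_and, if_true]
      rw [← Finset.mul_sum, sum_comp_restrict Tᶜ fun z =>
        if z = (fun j : (Tᶜ : Finset (Fin n)) => y j) then (1 : ℝ) else 0]
      have hT : T.card ≤ n := by simpa using Finset.card_le_univ T
      simp [Finset.card_compl, Nat.sub_sub_self hT]
    · simp [hs]
  rw [rotatedInstance_dist_X]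
  simp [hfill, mul_comm]

/-- The probability of the syndrome `s`, as a sum over those classes of errors, modulo the
stabilizers that fix the state, which have syndrome `s`. -/
theorem syndromeDist_subspaceState (Q : CSSCode) (θ : ℝ)
    {V : Matrix (Fin Q.n) (Fin Q.n) (ZMod 2)} (hV : IsUnit V)
    {S : Finset (Fin Q.n)} {C : Submodule (ZMod 2) (Fin Q.n → ZMod 2)}
    (hC : Submodule.span (ZMod 2) ((fun j i => V i j) '' (S : Set (Fin Q.n))) = C)
    (hT : Q.syndromeRegister ⊆ S) (s : Q.syndromeRegister → ZMod 2) :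
    Q.syndromeDist V θ (subspaceState C) s
      = ∑ z : S → ZMod 2, if (fun j : Q.syndromeRegister => z ⟨j, hT j.2⟩) = s
          then ‖classAmp θ V S z‖ ^ 2 else 0 := by
  simp only [CSSCode.syndromeDist, outcomeDist_subspaceState Q θ hV hC]
  rw [(bijective_transpose_mulVec hV).sum_comp fun y => if (fun j : Q.syndromeRegister => y j) = s
    then (⟨Q.n, V, S, fun _ => PauliAxis.X⟩ : RotatedInstance).dist θ y else 0]
  simp only [rotatedInstance_dist_X]
  rw [sum_comp_restrict S fun z => if (fun j : Q.syndromeRegister => z ⟨j, hT j.2⟩) = s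
    then (1 / 2 : ℝ) ^ Q.n * 2 ^ S.card * ‖classAmp θ V S z‖ ^ 2 else 0, Finset.mul_sum]
  have hS : S.card ≤ Q.n := by simpa using Finset.card_le_univ S
  refine Finset.sum_congr rfl fun z _ => ?_
  split_ifs
  · rw [← mul_assoc, mul_comm (2 ^ (Q.n - S.card)), half_pow_mul hS, one_mul]
  · simp

theorem syndromeDist_logicalZero {Q : CSSCode} {V : Matrix (Fin Q.n) (Fin Q.n) (ZMod 2)}
    (hV : Q.IsEncoder V) (θ : ℝ) :
    Q.syndromeDist V θ Q.logicalZero = fun s => ‖classAmp θ V Q.syndromeRegister s‖ ^ 2 := by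
  ext s
  rw [CSSCode.logicalZero, syndromeDist_subspaceState Q θ hV.1 hV.2.2 subset_rfl]
  simp

/-! ### Duality and decoding -/

theorem finrank_dualCode_add {n : ℕ} (C : Submodule (ZMod 2) (Fin n → ZMod 2)) :
    Module.finrank (ZMod 2) C + Module.finrank (ZMod 2) (dualCode C) = n := by
  have h : dualCode C = C.dualAnnihilator.comap
      (dotProductEquiv (ZMod 2) (Fin n)).toLinearMap := by
    ext x
    simp only [Submodule.mem_comap, Submodule.mem_dualAnnihilator]
    rfl
  rw [h, LinearEquiv.finrank_eq ((dotProductEquiv (ZMod 2) (Fin n)).submoduleMap _ |>.trans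
    (LinearEquiv.ofEq _ _ (Submodule.map_comap_eq_of_surjective
      (dotProductEquiv (ZMod 2) (Fin n)).surjective _))),
    Subspace.finrank_add_finrank_dualAnnihilator_eq]
  simp

theorem dualCode_dualCode {n : ℕ} (C : Submodule (ZMod 2) (Fin n → ZMod 2)) :
    dualCode (dualCode C) = C := by
  refine (Submodule.eq_of_le_of_finrank_eq (fun x hx y hy => ?_) ?_).symm
  · rw [dotProduct_comm]; exact hy x hx
  · have h1 := finrank_dualCode_add C
    have h2 := finrank_dualCode_add (dualCode C)
    omega

namespace CSSCode
variable (Q : CSSCode)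

theorem kx_le : Q.kx ≤ Q.n := by
  have := finrank_dualCode_add Q.CX
  rw [kx]; omega

theorem k_add_eq : Q.k + (Q.n - Q.kx) = Q.kz := by
  have h1 := finrank_dualCode_add Q.CZ
  have h2 := Submodule.finrank_mono Q.dual_le
  have := Q.kx_le
  rw [k]
  rw [kx] at *
  rw [kz]
  omega

theorem kz_le : Q.kz ≤ Q.n := by
  have := finrank_dualCode_add Q.CZ
  rw [kz]; omega

theorem card_plusRegister : Q.plusRegister.card = Q.k + (Q.n - Q.kx) := by
  rw [plusRegister, Fin.card_filter_val_lt, Q.k_add_eq, min_eq_right Q.kz_le]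

theorem syndromeRegister_subset : Q.syndromeRegister ⊆ Q.plusRegister := by
  intro j hj
  simp only [syndromeRegister, plusRegister, Finset.mem_filter] at *
  exact ⟨hj.1, hj.2.2⟩

theorem card_syndromeRegister : Q.syndromeRegister.card = Q.n - Q.kx := by
  have h : Q.syndromeRegister = Q.plusRegister \ Finset.univ.filter fun j => j.val < Q.k := by
    ext j
    simp only [syndromeRegister, plusRegister, Finset.mem_filter, Finset.mem_sdiff,
      Finset.mem_univ, true_and]
    omega
  have h1 := Q.k_add_eq
  have h2 := Q.kz_le
  rw [h, Finset.card_sdiff_of_subset, card_plusRegister, Fin.card_filter_val_lt]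
  · omega
  · intro j hj
    simp only [plusRegister, Finset.mem_filter, Finset.mem_univ, true_and] at hj ⊢
    omega

variable {Q}

/-- Errors that `C_X` corrects are determined by the syndrome. -/
theorem eq_of_syndrome_eq {V : Matrix (Fin Q.n) (Fin Q.n) (ZMod 2)} (hV : Q.IsEncoder V) {t : ℕ}
    (hcorr : CorrectsErrors Q.CX t) {e e' : Fin Q.n → ZMod 2} (he : hammingNorm e ≤ t)
    (he' : hammingNorm e' ≤ t)
    (h : ∀ j ∈ Q.syndromeRegister, V.transpose.mulVec e j = V.transpose.mulVec e' j) : e = e' := by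
  refine hcorr e e' he he' ?_
  rw [← dualCode_dualCode Q.CX, ← hV.2.2]
  intro y hy
  induction hy using Submodule.span_induction with
  | mem y hy =>
    obtain ⟨j, hj, rfl⟩ := hy
    have := h j hj
    rw [sub_dotProduct, dotProduct_comm, dotProduct_comm e']
    exact sub_eq_zero.2 this
  | zero => simp
  | add x y _ _ hx hy => rw [dotProduct_add, hx, hy, add_zero]
  | smul r x _ hx => rw [dotProduct_smul, hx, smul_zero]

/-- All errors supported on a fixed set of `m ≤ t` qubits have distinct syndromes. -/
theorem le_card_syndromeRegister {V : Matrix (Fin Q.n) (Fin Q.n) (ZMod 2)} (hV : Q.IsEncoder V)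
    {t m : ℕ} (hcorr : CorrectsErrors Q.CX t) (hmt : m ≤ t) (hmn : m ≤ Q.n) :
    m ≤ Q.syndromeRegister.card := by
  let pad : (Fin m → ZMod 2) → Fin Q.n → ZMod 2 := fun r i => if h : i.val < m then r ⟨i, h⟩ else 0
  have hw : ∀ r, hammingNorm (pad r) ≤ t := by
    intro r
    refine le_trans (Finset.card_le_card (t := Finset.univ.filter fun i : Fin Q.n => i.val < m)
      fun i hi => ?_) ?_
    · simp only [Finset.mem_filter, Finset.mem_univ, true_and] at hi ⊢
      by_contra h
      exact hi (dif_neg h)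
    · rw [Fin.card_filter_val_lt]; omega
  have hinj : Function.Injective fun r : Fin m → ZMod 2 =>
      fun j : Q.syndromeRegister => V.transpose.mulVec (pad r) j := by
    intro r r' h
    have he := eq_of_syndrome_eq hV hcorr (hw r) (hw r') fun j hj => congrFun h ⟨j, hj⟩
    ext1 i
    have := congrFun he ⟨i, i.2.trans_le hmn⟩
    simpa [pad] using this
  have := Fintype.card_le_of_injective _ hinj
  exact (Nat.pow_le_pow_iff_right (by norm_num : 1 < 2)).1 (by simpa [ZMod.card] using this)

end CSSCode

/-! ### Decoherence between correctable errors -/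

/-- If the elements of `G` have distinct labels, then summing amplitudes label by label differs
from summing probabilities over `G` only by the `ℓ¹`-weight `η` of the other amplitudes. -/
theorem sum_abs_normSq_sub_le {E Y : Type*} [Fintype E] [Fintype Y] [DecidableEq Y]
    (a : E → ℂ) (ha : ∀ e, ‖a e‖ ≤ 1) (G : E → Prop) [DecidablePred G] (h : E → Y)
    (hinj : ∀ e e', G e → G e' → h e = h e' → e = e') {η : ℝ}
    (hη : ∑ e, (if G e then 0 else ‖a e‖) ≤ η) :
    ∑ y, |‖∑ e, if h e = y then a e else 0‖ ^ 2 - ∑ e, if G e ∧ h e = y then ‖a e‖ ^ 2 else 0|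
      ≤ 2 * η + η ^ 2 := by
  let B : Y → ℝ := fun y => ∑ e, if ¬ G e ∧ h e = y then ‖a e‖ else 0
  have hB0 : ∀ y, 0 ≤ B y := fun y => Finset.sum_nonneg fun e _ => by split_ifs <;> simp
  have hBsum : ∑ y, B y ≤ η := by
    refine le_trans (le_of_eq ?_) hη
    simp only [B]
    rw [Finset.sum_comm]
    refine Finset.sum_congr rfl fun e _ => ?_
    by_cases he : G e <;> simp [he]
  have hη0 : 0 ≤ η := (Finset.sum_nonneg fun y _ => hB0 y).trans hBsum
  have hBle : ∀ y, B y ≤ η := fun y =>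
    (Finset.single_le_sum (fun y _ => hB0 y) (Finset.mem_univ y)).trans hBsum
  have hterm : ∀ y, |‖∑ e, if h e = y then a e else 0‖ ^ 2
      - ∑ e, if G e ∧ h e = y then ‖a e‖ ^ 2 else 0| ≤ B y * (2 + η) := by
    intro y
    -- At most one element `e₀` of `G` has label `y`; `m` is its amplitude, `r` all the rest.
    obtain ⟨m, hm1, hmG, hmS⟩ : ∃ m : ℂ, ‖m‖ ≤ 1 ∧
        (∑ e, if G e ∧ h e = y then a e else 0) = m ∧
        (∑ e, if G e ∧ h e = y then ‖a e‖ ^ 2 else 0) = ‖m‖ ^ 2 := by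
      by_cases hex : ∃ e₀, G e₀ ∧ h e₀ = y
      · obtain ⟨e₀, hG, hy⟩ := hex
        have huniq : ∀ e, (G e ∧ h e = y) ↔ e = e₀ := fun e =>
          ⟨fun he => hinj e e₀ he.1 hG (he.2.trans hy.symm), fun he => he ▸ ⟨hG, hy⟩⟩
        refine ⟨a e₀, ha e₀, ?_, ?_⟩
        · rw [Finset.sum_eq_single e₀ (fun e _ he => if_neg fun h' => he ((huniq e).1 h'))
            (by simp), if_pos ⟨hG, hy⟩]
        · rw [Finset.sum_eq_single e₀ (fun e _ he => if_neg fun h' => he ((huniq e).1 h'))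
            (by simp), if_pos ⟨hG, hy⟩]
      · push Not at hex
        refine ⟨0, by simp, ?_, ?_⟩
        · exact Finset.sum_eq_zero fun e _ => if_neg fun he => hex e he.1 he.2
        · rw [Finset.sum_eq_zero fun e _ => if_neg fun he => hex e he.1 he.2]; simp
    set r : ℂ := ∑ e, if ¬ G e ∧ h e = y then a e else 0 with hr
    have hsplit : (∑ e, if h e = y then a e else 0) = m + r := by
      rw [← hmG, hr, ← Finset.sum_add_distrib]
      refine Finset.sum_congr rfl fun e _ => ?_
      by_cases he : G e <;> simp [he]
    have hrB : ‖r‖ ≤ B y := by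
      refine (norm_sum_le _ _).trans (Finset.sum_le_sum fun e _ => ?_)
      split_ifs <;> simp
    rw [hsplit, hmS]
    have h1 : |‖m + r‖ - ‖m‖| ≤ ‖r‖ := by simpa using abs_norm_sub_norm_le (m + r) m
    have h2 : ‖m + r‖ + ‖m‖ ≤ 2 + η := by
      have := norm_add_le m r
      have := hBle y
      linarith
    calc |‖m + r‖ ^ 2 - ‖m‖ ^ 2| = |‖m + r‖ - ‖m‖| * (‖m + r‖ + ‖m‖) := by
          rw [sq_sub_sq, abs_mul, mul_comm, abs_of_nonneg (by positivity : 0 ≤ ‖m + r‖ + ‖m‖)]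
      _ ≤ B y * (2 + η) := mul_le_mul (h1.trans hrB) h2 (by positivity) (hB0 y)
  calc _ ≤ ∑ y, B y * (2 + η) := Finset.sum_le_sum fun y _ => hterm y
    _ = (∑ y, B y) * (2 + η) := by rw [Finset.sum_mul]
    _ ≤ η * (2 + η) := by gcongr
    _ = 2 * η + η ^ 2 := by ring

/-- Coarse-graining labels before or after squaring the amplitudes makes little difference if the
elements of `G` are distinguished already by the coarse labels. -/
theorem sum_abs_coarse_sub_le {E Y Z : Type*} [Fintype E] [Fintype Y] [DecidableEq Y] [Fintype Z]
    [DecidableEq Z] (a : E → ℂ) (ha : ∀ e, ‖a e‖ ≤ 1) (G : E → Prop) [DecidablePred G]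
    (f : E → Y) (g : Y → Z) (hinj : ∀ e e', G e → G e' → g (f e) = g (f e') → e = e') {η : ℝ}
    (hη : ∑ e, (if G e then 0 else ‖a e‖) ≤ η) :
    ∑ z, |(∑ y, if g y = z then ‖∑ e, if f e = y then a e else 0‖ ^ 2 else 0)
        - ‖∑ e, if g (f e) = z then a e else 0‖ ^ 2| ≤ 2 * (2 * η + η ^ 2) := by
  have h1 := sum_abs_normSq_sub_le a ha G f (fun e e' he he' h => hinj e e' he he' (by rw [h])) hη
  have h2 := sum_abs_normSq_sub_le a ha G (fun e => g (f e)) hinj hη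
  have hp : ∀ z, (∑ e, if G e ∧ g (f e) = z then ‖a e‖ ^ 2 else 0)
      = ∑ y, if g y = z then ∑ e, (if G e ∧ f e = y then ‖a e‖ ^ 2 else 0) else 0 := by
    intro z
    have : ∀ y, (if g y = z then ∑ e, (if G e ∧ f e = y then ‖a e‖ ^ 2 else 0) else 0)
        = ∑ e, if f e = y then (if G e ∧ g (f e) = z then ‖a e‖ ^ 2 else 0) else 0 := by
      intro y
      split_ifs with hy
      · refine Finset.sum_congr rfl fun e _ => ?_
        by_cases he : f e = y
        · simp [he, hy]
        · simp [he]
      · refine (Finset.sum_eq_zero fun e _ => ?_).symm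
        by_cases he : f e = y
        · simp [he, hy]
        · simp [he]
    simp only [this]
    rw [Finset.sum_comm]
    simp
  have h3 : ∑ z, |(∑ y, if g y = z then ‖∑ e, if f e = y then a e else 0‖ ^ 2 else 0)
        - ∑ e, if G e ∧ g (f e) = z then ‖a e‖ ^ 2 else 0|
      ≤ ∑ y, |‖∑ e, if f e = y then a e else 0‖ ^ 2
        - ∑ e, if G e ∧ f e = y then ‖a e‖ ^ 2 else 0| := by
    calc _ ≤ ∑ z, ∑ y, (if g y = z then |‖∑ e, if f e = y then a e else 0‖ ^ 2
        - ∑ e, if G e ∧ f e = y then ‖a e‖ ^ 2 else 0| else 0) := by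
          refine Finset.sum_le_sum fun z _ => ?_
          rw [hp, ← Finset.sum_sub_distrib]
          refine (Finset.abs_sum_le_sum_abs _ _).trans (Finset.sum_le_sum fun y _ => ?_)
          split_ifs <;> simp
      _ = _ := by rw [Finset.sum_comm]; simp
  calc _ ≤ ∑ z, (|(∑ y, if g y = z then ‖∑ e, if f e = y then a e else 0‖ ^ 2 else 0)
        - ∑ e, if G e ∧ g (f e) = z then ‖a e‖ ^ 2 else 0|
        + |‖∑ e, if g (f e) = z then a e else 0‖ ^ 2
          - ∑ e, if G e ∧ g (f e) = z then ‖a e‖ ^ 2 else 0|) := by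
        refine Finset.sum_le_sum fun z _ => ?_
        rw [abs_sub_comm (‖∑ e, if g (f e) = z then a e else 0‖ ^ 2)]
        exact abs_sub_le _ _ _
    _ ≤ _ := by rw [Finset.sum_add_distrib]; linarith

theorem norm_errorAmp_le {n : ℕ} (θ : ℝ) (e : Fin n → ZMod 2) :
    ‖errorAmp θ e‖ ≤ ∏ i, if e i = 0 then 1 else |Real.sin θ| := by
  rw [errorAmp, norm_prod]
  refine Finset.prod_le_prod (fun i _ => norm_nonneg _) fun i _ => ?_
  split_ifs
  · rw [Complex.norm_real]; exact Real.abs_cos_le_one θ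
  · rw [norm_mul, Complex.norm_I, one_mul, Complex.norm_real]; rfl

/-- A Chernoff bound: if `e² |sin θ| ≤ α`, the amplitudes of all errors of weight more than `α n`
together are exponentially small. -/
theorem sum_norm_errorAmp_tail_le {n t : ℕ} {θ α : ℝ} (hsin : |Real.sin θ| * Real.exp 2 ≤ α)
    (ht : α * n ≤ t) :
    ∑ e : Fin n → ZMod 2, (if hammingNorm e ≤ t then 0 else ‖errorAmp θ e‖)
      ≤ Real.exp (-α * n) := by
  have hterm : ∀ e : Fin n → ZMod 2, (if hammingNorm e ≤ t then 0 else ‖errorAmp θ e‖)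
      ≤ Real.exp (-2 * α * n) * ∏ i, if e i = 0 then 1 else |Real.sin θ| * Real.exp 2 := by
    intro e
    have hprod : (∏ i, if e i = 0 then (1 : ℝ) else |Real.sin θ| * Real.exp 2)
        = (∏ i, if e i = 0 then 1 else |Real.sin θ|) * Real.exp (2 * hammingNorm e) := by
      have : Real.exp (2 * hammingNorm e) = ∏ i, if e i = 0 then (1 : ℝ) else Real.exp 2 := by
        rw [mul_comm, Real.exp_nat_mul, hammingNorm, ← Finset.prod_const, Finset.prod_filter]
        refine Finset.prod_congr rfl fun i _ => ?_
        by_cases h : e i = 0 <;> simp [h]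
      rw [this, ← Finset.prod_mul_distrib]
      refine Finset.prod_congr rfl fun i _ => ?_
      split_ifs <;> simp
    have h0 : 0 ≤ ∏ i, if e i = 0 then (1 : ℝ) else |Real.sin θ| :=
      Finset.prod_nonneg fun i _ => by split_ifs <;> positivity
    split_ifs with he
    · rw [hprod]; positivity
    · rw [hprod, mul_left_comm, ← Real.exp_add]
      refine (norm_errorAmp_le θ e).trans (le_mul_of_one_le_right h0 (Real.one_le_exp ?_))
      have : (t : ℝ) ≤ hammingNorm e := by exact_mod_cast (not_le.1 he).le
      linarith
  refine (Finset.sum_le_sum fun e _ => hterm e).trans ?_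
  rw [← Finset.mul_sum, ← Fintype.prod_sum fun (_ : Fin n) (b : ZMod 2) =>
    if b = 0 then (1 : ℝ) else |Real.sin θ| * Real.exp 2]
  simp only [sum_zmod_two, if_true, one_ne_zero, if_false, Finset.prod_const, Finset.card_univ,
    Fintype.card_fin]
  calc Real.exp (-2 * α * n) * (1 + |Real.sin θ| * Real.exp 2) ^ n
      ≤ Real.exp (-2 * α * n) * Real.exp α ^ n := by
        gcongr
        have := Real.add_one_le_exp (|Real.sin θ| * Real.exp 2)
        have := Real.exp_le_exp.2 hsin
        linarith
    _ = Real.exp (-α * n) := by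
        rw [← Real.exp_nat_mul, ← Real.exp_add]
        congr 1; ring

theorem abs_sin_mul_exp_two_le {θ α : ℝ} (hα : 0 < α) (hα1 : α < 1)
    (hθ : |θ| ≤ Real.arcsin (α / (2 * Real.exp 1 * (4 * Real.exp 1 + 2)))) :
    |Real.sin θ| * Real.exp 2 ≤ α := by
  have he : 1 ≤ Real.exp 1 := Real.one_le_exp (by norm_num)
  have he2 : Real.exp 2 = Real.exp 1 * Real.exp 1 := by rw [← Real.exp_add]; norm_num
  set D := 2 * Real.exp 1 * (4 * Real.exp 1 + 2) with hD
  have hDe : Real.exp 2 ≤ D := by rw [he2, hD]; nlinarith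
  have hD1 : 1 ≤ D := by nlinarith
  have hx : α / D ≤ 1 := (div_le_one (by positivity)).2 (by linarith)
  have hpi := Real.arcsin_le_pi_div_two (α / D)
  have hs : |Real.sin θ| ≤ α / D := by
    rw [Real.abs_sin_eq_sin_abs_of_abs_le_pi (by linarith [Real.pi_pos]),
      ← Real.sin_arcsin (x := α / D) (by linarith [div_pos hα (by positivity : 0 < D)]) hx]
    exact Real.sin_le_sin_of_le_of_le_pi_div_two (by linarith [Real.pi_pos, abs_nonneg θ]) hpi hθ
  calc |Real.sin θ| * Real.exp 2 ≤ α / D * D := by gcongr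
    _ = α := by field_simp

/-- The syndrome distribution hardly depends on whether the logical qubits are in `|+⟩` or
in `|0⟩`. -/
theorem tvDist_syndromeDist_le (Q : CSSCode) {V : Matrix (Fin Q.n) (Fin Q.n) (ZMod 2)}
    (hV : Q.IsEncoder V) {t : ℕ} (hcorr : CorrectsErrors Q.CX t) {θ α : ℝ}
    (hsin : |Real.sin θ| * Real.exp 2 ≤ α) (ht : α * Q.n ≤ t) :
    tvDist (Q.syndromeDist V θ Q.logicalPlus) (Q.syndromeDist V θ Q.logicalZero)
      ≤ 3 * Real.exp (-α * Q.n) := by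
  have hα : 0 ≤ α := le_trans (by positivity) hsin
  set η := Real.exp (-α * Q.n) with hη
  have hη0 : 0 < η := Real.exp_pos _
  have hη1 : η ≤ 1 := Real.exp_le_one_iff.2 (by
    have : 0 ≤ α * Q.n := by positivity
    linarith)
  have hamp : ∀ e : Fin Q.n → ZMod 2, ‖errorAmp θ e‖ ≤ 1 := fun e =>
    (norm_errorAmp_le θ e).trans (Finset.prod_le_one (fun i _ => by split_ifs <;> positivity)
      fun i _ => by split_ifs; exacts [le_rfl, Real.abs_sin_le_one θ])
  have key := sum_abs_coarse_sub_le (errorAmp θ) hamp (fun e => hammingNorm e ≤ t)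
    (fun e (j : Q.plusRegister) => V.transpose.mulVec e j)
    (fun z (j : Q.syndromeRegister) => z ⟨j, Q.syndromeRegister_subset j.2⟩)
    (fun e e' he he' h => CSSCode.eq_of_syndrome_eq hV hcorr he he'
      fun j hj => congrFun h ⟨j, hj⟩) (sum_norm_errorAmp_tail_le hsin ht)
  have hp : ∀ s, Q.syndromeDist V θ Q.logicalPlus s = _ :=
    syndromeDist_subspaceState Q θ hV.1 hV.2.1 Q.syndromeRegister_subset
  simp only [tvDist, hp, syndromeDist_logicalZero hV, classAmp]
  nlinarith

/-! ### Comparison of sampling times -/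

theorem Samplable.comp_mulVec {n : ℕ} {δ : ℝ} {D : (Fin n → ZMod 2) → ℝ} (h : Samplable δ D)
    {M : Matrix (Fin n) (Fin n) (ZMod 2)} (hM : IsUnit M) :
    Samplable δ (fun x => D (M.mulVec x)) ∧
      samplingTime δ (fun x => D (M.mulVec x)) ≤ samplingTime δ D + n * (n + 1) := by
  obtain ⟨W, hMW, hWM⟩ := isUnit_iff_exists.1 hM
  refine h.push (fun y => PMF.pure (W.mulVec y)) _
    (fun A => by simpa using A.exists_map_mulVec W) fun x => ?_
  have hiff : ∀ y, x = W.mulVec y ↔ y = M.mulVec x := by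
    intro y
    constructor <;> rintro rfl <;> simp [hMW, hWM]
  simp only [PMF.toReal_pure_apply, hiff]
  simp

/-- Sampling the protocol and sampling the rotated product state differ by a CNOT network. -/
theorem samplable_outcomeDist {Q : CSSCode} {V : Matrix (Fin Q.n) (Fin Q.n) (ZMod 2)}
    (hV : Q.IsEncoder V) {θ δ : ℝ} (h : Samplable δ ((Q.fullInstance V).dist θ)) :
    Q.simulationTime θ δ
        ≤ samplingTime δ ((Q.fullInstance V).dist θ) + Q.n * (Q.n + 1) ∧
      samplingTime δ ((Q.fullInstance V).dist θ)
        ≤ Q.simulationTime θ δ + Q.n * (Q.n + 1) := by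
  have hVt : IsUnit V.transpose := (Matrix.isUnit_transpose V).2 hV.1
  obtain ⟨W, hVW, hWV⟩ := isUnit_iff_exists.1 hVt
  have hO : Q.outcomeDist θ Q.logicalPlus
      = fun x => (Q.fullInstance V).dist θ (V.transpose.mulVec x) :=
    funext (outcomeDist_subspaceState Q θ hV.1 hV.2.1)
  have hF : (Q.fullInstance V).dist θ
      = fun y => Q.outcomeDist θ Q.logicalPlus (W.mulVec y) := by
    rw [hO]
    refine funext fun (y : Fin Q.n → ZMod 2) => congrArg ((Q.fullInstance V).dist θ) ?_
    rw [Matrix.mulVec_mulVec, hVW, Matrix.one_mulVec]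
  obtain ⟨h1, h2⟩ := Samplable.comp_mulVec (n := Q.n) h hVt
  rw [← hO] at h1 h2
  obtain ⟨-, h3⟩ := h1.comp_mulVec (isUnit_iff_exists.2 ⟨_, hWV, hVW⟩ : IsUnit W)
  rw [← hF] at h3
  exact ⟨h2, h3⟩

/-- The syndrome is part of the outcome of the rotated product state, and all other outcome bits
are fair coins. -/
theorem samplable_syndromeDist {Q : CSSCode} {V : Matrix (Fin Q.n) (Fin Q.n) (ZMod 2)}
    (hV : Q.IsEncoder V) {θ δ : ℝ} (h : Samplable δ ((Q.zeroInstance V).dist θ)) :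
    Samplable δ (Q.syndromeDist V θ Q.logicalZero) ∧
      Q.verificationTime V θ δ ≤ samplingTime δ ((Q.zeroInstance V).dist θ) ∧
      samplingTime δ ((Q.zeroInstance V).dist θ) ≤ Q.verificationTime V θ δ + Q.n := by
  obtain ⟨h1, h2⟩ := Samplable.push (κ := Fin Q.n) (D' := Q.syndromeDist V θ Q.logicalZero) h
    (fun y => PMF.pure (y ∘ ((↑) : Q.syndromeRegister → Fin Q.n))) 0
    (fun A => A.exists_map_comp _) (fun s => by
      simp only [CSSCode.syndromeDist, CSSCode.logicalZero,
        outcomeDist_subspaceState Q θ hV.1 hV.2.2]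
      rw [(bijective_transpose_mulVec hV.1).sum_comp fun y =>
        if (fun j : Q.syndromeRegister => y j) = s then
          (⟨Q.n, V, Q.syndromeRegister, fun _ => PauliAxis.X⟩ : RotatedInstance).dist θ y else 0]
      refine Finset.sum_congr rfl fun y _ => ?_
      rw [PMF.toReal_pure_apply, mul_ite, mul_one, mul_zero]
      exact if_congr eq_comm rfl rfl)
  obtain ⟨-, h3⟩ := Samplable.push (D' := (Q.zeroInstance V).dist θ) h1
    (coinFill Q.syndromeRegister) Q.n (fun A => A.exists_bind_coinFill _) (fun y => by
      rw [syndromeDist_logicalZero hV]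
      exact rotatedInstance_dist_eq_coinFill θ V Q.syndromeRegister y)
  exact ⟨h1, h2, h3⟩

/-! ### Asymptotics -/

/-- Overheads `m` of lower order on either side preserve the growth `Θ(s)`. -/
theorem isTheta_of_le_add {ι : Type*} {l : Filter ι} {f g m : ι → ℕ} {s : ι → ℝ}
    (hg : (fun i => (g i : ℝ)) =Θ[l] s) (hm : (fun i => (m i : ℝ)) =o[l] s)
    (hfg : ∀ᶠ i in l, f i ≤ g i + m i ∧ g i ≤ f i + m i) : (fun i => (f i : ℝ)) =Θ[l] s := by
  have hd : (fun i => (f i : ℝ) - g i) =o[l] s := by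
    refine IsBigO.trans_isLittleO (IsBigO.of_bound 1 ?_) hm
    filter_upwards [hfg] with i ⟨h1, h2⟩
    have h1' : (f i : ℝ) ≤ g i + m i := by exact_mod_cast h1
    have h2' : (g i : ℝ) ≤ f i + m i := by exact_mod_cast h2
    rw [one_mul, Real.norm_natCast, Real.norm_eq_abs, abs_le]
    constructor <;> linarith
  have hf : (fun i => (f i : ℝ)) = (fun i => (g i : ℝ)) + fun i => (f i : ℝ) - g i := by
    ext i; simp
  rw [hf]
  exact hg.add_isLittleO hd

theorem isLittleO_quadratic_two_rpow {ι : Type*} {l : Filter ι} {n : ι → ℕ}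
    (hn : Tendsto n l atTop) {c α : ℝ} (hc : 0 < c) (hα : 0 < α) {a : ι → ℝ}
    (ha : ∀ i, α * n i ≤ a i) :
    (fun i => ((n i * (n i + 1) : ℕ) : ℝ)) =o[l] fun i => (2 : ℝ) ^ (c * a i) := by
  have hb : 0 < Real.log 2 * (c * α) := by positivity
  have h1 : (fun x : ℝ => x ^ 2) =o[atTop] fun x => Real.exp (Real.log 2 * (c * α) * x) :=
    isLittleO_pow_exp_pos_mul_atTop 2 hb
  have h2 := h1.comp_tendsto (tendsto_natCast_atTop_atTop.comp hn)
  refine ((IsBigO.of_bound 2 (Eventually.of_forall fun i => ?_)).trans_isLittleO h2).trans_isBigO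
    (IsBigO.of_bound 1 (Eventually.of_forall fun i => ?_))
  · simp only [Function.comp, Real.norm_natCast, norm_pow]
    have : n i ≤ n i ^ 2 := Nat.le_self_pow (by norm_num) _
    have h' : (n i * (n i + 1)) ≤ 2 * n i ^ 2 := by nlinarith
    exact_mod_cast h'
  · simp only [Function.comp]
    rw [one_mul, Real.norm_of_nonneg (Real.exp_pos _).le, Real.norm_of_nonneg (by positivity),
      Real.rpow_def_of_pos (by norm_num)]
    refine Real.exp_le_exp.2 ?_
    rw [mul_assoc, mul_assoc]
    gcongr
    exact ha i

theorem mainTheorem4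
    (θ c α : ℝ) (hc : 0 < c) (hα : 0 < α) (hα1 : α < 1)
    (hθ : |θ| ≤ Real.arcsin (α / (2 * Real.exp 1 * (4 * Real.exp 1 + 2))))
    (δ : ℕ → ℝ) (hδ : ∀ n, 0 < δ n)
    -- a class of states of the given form with Pauli bases, on which sampling takes `Θ(2^(c a))`
    (𝓢 : Set RotatedInstance)
    (hcost : (fun S : RotatedInstance => (samplingTime (δ S.n) (S.dist θ) : ℝ))
      =Θ[comap RotatedInstance.a atTop ⊓ 𝓟 𝓢] fun S => (2 : ℝ) ^ (c * (S.a : ℝ)))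
    -- a family of codes, where `C_X` corrects a constant fraction of errors
    {ι : Type*} (l : Filter ι) (Q : ι → CSSCode)
    (V : (i : ι) → Matrix (Fin (Q i).n) (Fin (Q i).n) (ZMod 2))
    (hV : ∀ i, (Q i).IsEncoder (V i))
    (hn : Tendsto (fun i => (Q i).n) l atTop)
    (t : ι → ℕ) (ht : ∀ i, α * ((Q i).n : ℝ) ≤ (t i : ℝ))
    (hcorr : ∀ i, CorrectsErrors (Q i).CX (t i))
    -- whose states belong to the class
    (hfull : ∀ i, (Q i).fullInstance (V i) ∈ 𝓢)
    (hzero : ∀ i, (Q i).zeroInstance (V i) ∈ 𝓢) :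
    ((fun i => ((Q i).simulationTime θ (δ (Q i).n) : ℝ))
      =Θ[l] fun i => (2 : ℝ) ^ (c * (((Q i).k : ℝ) + (Q i).n - (Q i).kx))) ∧
    ((fun i => ((Q i).verificationTime (V i) θ (δ (Q i).n) : ℝ))
      =Θ[l] fun i => (2 : ℝ) ^ (c * (((Q i).n : ℝ) - (Q i).kx))) ∧
    ((fun i => ((Q i).simulationTime θ (δ (Q i).n) : ℝ)
        / ((Q i).verificationTime (V i) θ (δ (Q i).n) : ℝ))
      =Θ[l] fun i => (2 : ℝ) ^ (c * ((Q i).k : ℝ))) ∧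
    -- it also suffices for the ideal syndrome distribution, up to an additional error ...
    ((fun i => (samplingTime
        (δ (Q i).n + tvDist ((Q i).syndromeDist (V i) θ (Q i).logicalPlus)
          ((Q i).syndromeDist (V i) θ (Q i).logicalZero))
        ((Q i).syndromeDist (V i) θ (Q i).logicalPlus) : ℝ))
      =O[l] fun i => (2 : ℝ) ^ (c * (((Q i).n : ℝ) - (Q i).kx))) ∧
    -- ... which is negligible in `n`
    (∀ p : ℕ, Tendsto (fun i => ((Q i).n : ℝ) ^ p *
        tvDist ((Q i).syndromeDist (V i) θ (Q i).logicalPlus)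
          ((Q i).syndromeDist (V i) θ (Q i).logicalZero)) l (𝓝 0)) := by
  have hnα : ∀ i, α * (Q i).n ≤ ((Q i).syndromeRegister.card : ℝ) := by
    intro i
    have h := CSSCode.le_card_syndromeRegister (hV i) (hcorr i) (min_le_left (t i) (Q i).n)
      (min_le_right _ _)
    refine le_trans (le_min (ht i) (mul_le_of_le_one_left (Nat.cast_nonneg _) hα1.le)) ?_
    exact_mod_cast h
  have hcardS : ∀ i, ((Q i).syndromeRegister.card : ℝ) = ((Q i).n : ℝ) - (Q i).kx := by
    intro i
    rw [(Q i).card_syndromeRegister, Nat.cast_sub (Q i).kx_le]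
  have hcardP : ∀ i, ((Q i).plusRegister.card : ℝ) = ((Q i).k : ℝ) + (Q i).n - (Q i).kx := by
    intro i
    rw [(Q i).card_plusRegister, Nat.cast_add, Nat.cast_sub (Q i).kx_le]; ring
  have hle : ∀ i, (Q i).syndromeRegister.card ≤ (Q i).plusRegister.card := fun i =>
    Finset.card_le_card (Q i).syndromeRegister_subset
  have hSinf : Tendsto (fun i => (Q i).syndromeRegister.card) l atTop := by
    refine tendsto_natCast_atTop_iff.1 (tendsto_atTop_mono hnα ?_)
    exact (tendsto_natCast_atTop_atTop.comp hn).const_mul_atTop hα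
  have hPinf : Tendsto (fun i => (Q i).plusRegister.card) l atTop := tendsto_atTop_mono hle hSinf
  have hF : Tendsto (fun i => (Q i).fullInstance (V i)) l
      (comap RotatedInstance.a atTop ⊓ 𝓟 𝓢) :=
    tendsto_inf.2 ⟨tendsto_comap_iff.2 hPinf, tendsto_principal.2 (Eventually.of_forall hfull)⟩
  have hZ : Tendsto (fun i => (Q i).zeroInstance (V i)) l
      (comap RotatedInstance.a atTop ⊓ 𝓟 𝓢) :=
    tendsto_inf.2 ⟨tendsto_comap_iff.2 hSinf, tendsto_principal.2 (Eventually.of_forall hzero)⟩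
  have hFcost : (fun i => (samplingTime (δ (Q i).n) (((Q i).fullInstance (V i)).dist θ) : ℝ))
      =Θ[l] fun i => (2 : ℝ) ^ (c * (((Q i).k : ℝ) + (Q i).n - (Q i).kx)) := by
    have ha : ∀ i, (((Q i).fullInstance (V i)).a : ℝ) = _ := hcardP
    simp only [← ha]
    exact ⟨hcost.1.comp_tendsto hF, hcost.2.comp_tendsto hF⟩
  have hZcost : (fun i => (samplingTime (δ (Q i).n) (((Q i).zeroInstance (V i)).dist θ) : ℝ))
      =Θ[l] fun i => (2 : ℝ) ^ (c * (((Q i).n : ℝ) - (Q i).kx)) := by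
    have ha : ∀ i, (((Q i).zeroInstance (V i)).a : ℝ) = _ := hcardS
    simp only [← ha]
    exact ⟨hcost.1.comp_tendsto hZ, hcost.2.comp_tendsto hZ⟩
  -- A positive sampling time shows that the set of samplers behind it is not empty.
  have hFs : ∀ᶠ i in l, Samplable (δ (Q i).n) (((Q i).fullInstance (V i)).dist θ) := by
    filter_upwards [hFcost.2.eq_zero_imp] with i hi
    refine samplable_of_samplingTime_pos (Nat.pos_of_ne_zero fun h0 => ?_)
    exact (Real.rpow_pos_of_pos two_pos _).ne' (hi (by exact_mod_cast h0))
  have hZs : ∀ᶠ i in l, Samplable (δ (Q i).n) (((Q i).zeroInstance (V i)).dist θ) := by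
    filter_upwards [hZcost.2.eq_zero_imp] with i hi
    refine samplable_of_samplingTime_pos (Nat.pos_of_ne_zero fun h0 => ?_)
    exact (Real.rpow_pos_of_pos two_pos _).ne' (hi (by exact_mod_cast h0))
  have hsim : (fun i => ((Q i).simulationTime θ (δ (Q i).n) : ℝ))
      =Θ[l] fun i => (2 : ℝ) ^ (c * (((Q i).k : ℝ) + (Q i).n - (Q i).kx)) := by
    refine isTheta_of_le_add hFcost (isLittleO_quadratic_two_rpow hn hc hα fun i => ?_)
      (hFs.mono fun i hi => samplable_outcomeDist (hV i) hi)
    rw [← hcardP]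
    exact (hnα i).trans (by exact_mod_cast hle i)
  have hver : (fun i => ((Q i).verificationTime (V i) θ (δ (Q i).n) : ℝ))
      =Θ[l] fun i => (2 : ℝ) ^ (c * (((Q i).n : ℝ) - (Q i).kx)) := by
    refine isTheta_of_le_add hZcost (isLittleO_quadratic_two_rpow hn hc hα fun i => ?_)
      (hZs.mono fun i hi => ?_)
    · rw [← hcardS]; exact hnα i
    · obtain ⟨-, h1, h2⟩ := samplable_syndromeDist (hV i) hi
      exact ⟨h1.trans (Nat.le_add_right _ _), h2.trans (by nlinarith)⟩
  have hsin := abs_sin_mul_exp_two_le hα hα1 hθ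
  refine ⟨hsim, hver, ?_, ?_, fun p => ?_⟩
  · refine (hsim.div hver).trans_eventuallyEq (Eventually.of_forall fun i => ?_)
    simp only
    rw [← Real.rpow_sub two_pos]
    congr 1; ring
  · refine IsBigO.trans (IsBigO.of_bound 1 ?_) hver.1
    filter_upwards [hZs] with i hi
    rw [one_mul, Real.norm_natCast, Real.norm_natCast, Nat.cast_le]
    exact samplingTime_add_tvDist_le (samplable_syndromeDist (hV i) hi).1
  · have h0 : Tendsto (fun x : ℝ => 3 * (x ^ p / Real.exp (α * x))) atTop (𝓝 0) := by
      simpa using ((isLittleO_pow_exp_pos_mul_atTop p hα).tendsto_div_nhds_zero).const_mul 3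
    refine squeeze_zero (fun i => mul_nonneg (by positivity) (tvDist_nonneg _ _)) (fun i => ?_)
      (h0.comp (tendsto_natCast_atTop_atTop.comp hn))
    refine (mul_le_mul_of_nonneg_left
      (tvDist_syndromeDist_le (Q i) (hV i) (hcorr i) hsin (ht i)) (by positivity)).trans_eq ?_
    simp only [Function.comp, neg_mul, Real.exp_neg]
    ring
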